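/- **Setting.** Let $n_u,n_w,n_z,n_{q_1},n_{q_2},n_{q_3}$ be non-negative integers. Let $W_2^{n}$ be the space of all $u\in L_2^{n}[[0,1]^2]$ whose weak derivatives $\partial_x^i\partial_y^j u$, $0\le i,j\le 2$, lie in $L_2^{n}[[0,1]^2]$. For $u\in W_2^{n}$ collect the boundary values $$\Lambda_1u=\big((\partial_x^i\partial_y^ju)(a,b)\big)_{i,j,a,b\in\{0,1\}}\in\mathbb R^{16n},\quad \Lambda_2u=\big(x\mapsto\partial_x^2\partial_y^ju(x,b)\big)_{j,b\in\{0,1\}},\quad \Lambda_3u=\big(y\mapsto\partial_x^i\partial_y^2u(a,y)\big)_{i,a\in\{0,1\}},$$ where $\Lambda_2u,\Lambda_3u\in L_2^{4n}[0,1]$, and set $\Lambda_{\rm bf}=(\Lambda_1,\Lambda_2,\Lambda_3)$. Write $\mathrm M[N]$ for multiplication by a matrix-valued function $N$ and $\int_{[0,1]^2}[N]f=\int_0^1\!\int_0^1N f$. For $E\in\mathbb R^{8n_u\times 24n_u}$ let $$X=\{u\in W_2^{n_u}\mid \mathrm M[E]\Lambda_{\rm bf}u=0\},$$ i.e. $E\,(\Lambda_1u,(\Lambda_2u)(x),(\Lambda_3u)(y))=0$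 for almost every $(x,y)$. Assume that the boundary conditions are well-posed: $\partial_x^2\partial_y^2:X\to L_2^{n_u}[[0,1]^2]$ is bijective. Let $A_{ij}\in L_\infty^{n_u\times n_u}[[0,1]^2]$, $B\in L_2^{n_u\times n_w}[[0,1]^2]$, $C_{ij}\in L_2^{n_z\times n_u}[[0,1]^2]$ $(0\le i,j\le2)$, $D\in\mathbb R^{n_z\times n_w}$, $C_1\in\mathbb R^{n_{q_1}\times16n_u}$, $D_1\in\mathbb R^{n_{q_1}\times n_w}$, and, for $k=2,3$, $C_k\in L_2^{n_{q_k}\times4n_u}[0,1]$, $D_k\in L_2^{n_{q_k}\times n_w}[0,1]$, such that $\mathrm M[C_k]\Lambda_ku\in L_2^{n_{q_k}}[0,1]$ for all $u\in X$ (automatic if $C_k$ is bounded). A solution $(u,z,q)$, $q=(q_1,q_2,q_3)$, of the PDE with disturbance $w:[0,\infty)\to\mathbb R^{n_w}$ and initial state $u_0\in X$ consists of functions of $t\ge0$ with values in $X$, $\mathbb R^{n_z}$ and $\mathbb R^{n_{q_1}}\times L_2^{n_{q_2}}[0,1]\times L_2^{n_{q_3}}[0,1]$ such that $u$ is differentiable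 as a map into $L_2^{n_u}[[0,1]^2]$, $u(0)=u_0$, and for all $t\ge0$ $$u_t=\sum_{i,j=0}^2\mathrm M[A_{ij}]\partial_x^i\partial_y^ju+\mathrm M[B]w,\quad z=\sum_{i,j=0}^2\int_{[0,1]^2}[C_{ij}]\,\partial_x^i\partial_y^ju+Dw,\quad q_k=\mathrm M[C_k]\Lambda_ku+\mathrm M[D_k]w\ (k=1,2,3).$$ Let $\mathcal T$ be the inverse of $\partial_x^2\partial_y^2:X\to L_2^{n_u}[[0,1]^2]$, regarded as an operator on $L_2^{n_u}[[0,1]^2]$, and put $$\mathcal A=\sum_{i,j}\mathrm M[A_{ij}]\partial_x^i\partial_y^j\mathcal T,\quad \mathcal B=\mathrm M[B],\quad \mathcal C=\sum_{i,j}\int_{[0,1]^2}[C_{ij}]\,\partial_x^i\partial_y^j\mathcal T,\quad \mathcal D=D,\quad \mathcal C_q=\big(\mathrm M[C_k]\Lambda_k\mathcal T\big)_{k=1,2,3},\quad \mathcal D_q=\big(\mathrm M[D_k]\big)_{k=1,2,3}.$$ A *2D PI operator* is a bounded operator $\mathcal R:L_2^{n}[[0,1]^2]\to L_2^{m}[[0,1]^2]$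 such that, with square-integrable matrix-valued parameters $R_{ij}$, $0\le i,j\le 2$, for every $v$, $(\mathcal Rv)(x,y)$ is for almost every $(x,y)$ the sum of $R_{00}(x,y)v(x,y)$, $\int_{I_i}R_{i0}(x,y,\theta)v(\theta,y)\,d\theta$, $\int_{J_j}R_{0j}(x,y,\eta)v(x,\eta)\,d\eta$ and $\int_{I_i}\int_{J_j}R_{ij}(x,y,\theta,\eta)v(\theta,\eta)\,d\eta\,d\theta$ over $i,j\in\{1,2\}$, where $I_1=[0,x]$, $I_2=[x,1]$, $J_1=[0,y]$, $J_2=[y,1]$. PI operators $\mathbb R^{n}\to L_2^{m}[[0,1]^2]$ are the operators $\mathrm M[K]$ with $K\in L_2$. PI operators $L_2^n[0,1]\to L_2^m[[0,1]^2]$ are the bounded operators of the form $f\mapsto Q_0(x,y)f(x)+\int_0^xQ_1(x,y,\theta)f(\theta)\,d\theta+\int_x^1Q_2(x,y,\theta)f(\theta)\,d\theta$ with square-integrable $Q_0,Q_1,Q_2$, or of the same form with $f(y)$, $\int_0^y$, $\int_y^1$ in place of $f(x)$, $\int_0^x$, $\int_x^1$. **Theorem.** Suppose that there are $\gamma>0$,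 a 2D PI operator $\mathcal P$ on $L_2^{n_u}[[0,1]^2]$ and an operator $\mathcal W=[\mathcal W_1\ \mathcal W_2\ \mathcal W_3]:\mathbb R^{n_{q_1}}\times L_2^{n_{q_2}}[0,1]\times L_2^{n_{q_3}}[0,1]\to L_2^{n_u}[[0,1]^2]$ with PI operators $\mathcal W_1,\mathcal W_2,\mathcal W_3$, such that $\mathcal P=\mathcal P^*\succ0$ (that is, $\langle v,\mathcal Pv\rangle\ge\varepsilon\|v\|^2$ for some $\varepsilon>0$ and all $v$) and $$\begin{bmatrix}-\gamma I&-\mathcal D&\mathcal C\\(\cdot)^*&-\gamma I&-[\mathcal B^*\mathcal P+\mathcal D_q^*\mathcal W^*]\mathcal T\\(\cdot)^*&(\cdot)^*&(\cdot)^*+\mathcal T^*[\mathcal P\mathcal A+\mathcal W\mathcal C_q]\end{bmatrix}\preceq0,$$ and let $\mathcal L=\mathcal P^{-1}\mathcal W$. Let $(u,z,q)$ be a solution of the PDE for some $w\in L_2^{n_w}[0,\infty)$ and $u_0\in X$, and let $(\hat v,\hat z)$ be a solution of the estimator $$\mathcal T\hat v_t(t)=\mathcal A\hat v(t)+\mathcal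 L(\mathcal C_q\hat v(t)-q(t)),\qquad \hat z(t)=\mathcal C\hat v(t)\qquad(t\ge0),$$ with $\hat v:[0,\infty)\to L_2^{n_u}[[0,1]^2]$ differentiable and $\hat v(0)=\partial_x^2\partial_y^2u_0$. Then $\hat z-z\in L_2^{n_z}[0,\infty)$ and $\|\hat z-z\|_{L_2}\le\gamma\|w\|_{L_2}$. -/

import Mathlib

open MeasureTheory
open scoped ENNReal ContDiff

namespace PIE2D

noncomputable section

/-! ### Function spaces on `[0,1]` and `[0,1]²` -/

/-- Lebesgue measure on the interval `[0,1]`. -/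
abbrev μI : Measure ℝ := volume.restrict (Set.Icc 0 1)

instance instProbI : IsProbabilityMeasure μI := ⟨by simp⟩

/-- Lebesgue measure on the square `[0,1]²`. -/
abbrev μS : Measure (ℝ × ℝ) := μI.prod μI

/-- Lebesgue measure on the half line `[0,∞)` (the time axis). -/
abbrev μT : Measure ℝ := volume.restrict (Set.Ici 0)

/-- Euclidean vectors with coordinates indexed by `ι`. -/
abbrev Vec (ι : Type) [Fintype ι] := EuclideanSpace ℝ ι

/-- Vector-valued square-integrable functions on `[0,1]`. -/
abbrev L2I (ι : Type) [Fintype ι] := Lp (Vec ι) 2 μI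

/-- Vector-valued square-integrable functions on `[0,1]²`. -/
abbrev L2S (ι : Type) [Fintype ι] := Lp (Vec ι) 2 μS

/-- Matrix times Euclidean vector. -/
def mv {κ ι : Type} [Fintype κ] [Fintype ι] (N : Matrix κ ι ℝ) (v : Vec ι) : Vec κ :=
  WithLp.toLp 2 (N.mulVec v.ofLp)

/-- A matrix-valued function all of whose entries lie in `L^p`. -/
def MatMemLp {α κ ι : Type} [MeasurableSpace α] (N : α → Matrix κ ι ℝ) (p : ℝ≥0∞)
    (μ : Measure α) : Prop :=
  ∀ k l, MemLp (fun a => N a k l) p μ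

section Multipliers

variable {α κ ι : Type} [MeasurableSpace α] {μ : Measure α} [Fintype κ] [Fintype ι]

theorem mv_apply (N : Matrix κ ι ℝ) (v : Vec ι) (k : κ) : mv N v k = ∑ l, N k l * v l := rfl

theorem mv_add (N : Matrix κ ι ℝ) (v w : Vec ι) : mv N (v + w) = mv N v + mv N w := by
  ext k; simp [mv_apply, mul_add, Finset.sum_add_distrib]

theorem mv_smul (N : Matrix κ ι ℝ) (c : ℝ) (v : Vec ι) : mv N (c • v) = c • mv N v := by
  ext k; simp [mv_apply, Finset.mul_sum, mul_left_comm]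

theorem continuous_mv (N : Matrix κ ι ℝ) : Continuous (mv N) := by
  have : mv N = LinearMap.toContinuousLinearMap
      ({ toFun := mv N, map_add' := mv_add N, map_smul' := mv_smul N } : Vec ι →ₗ[ℝ] Vec κ) := rfl
  rw [this]; exact ContinuousLinearMap.continuous _

/-- A constant matrix acting on vectors, as a bounded operator. -/
def mvL (N : Matrix κ ι ℝ) : Vec ι →L[ℝ] Vec κ :=
  LinearMap.toContinuousLinearMap
    { toFun := mv N, map_add' := mv_add N, map_smul' := mv_smul N }

theorem memLp_mv {N : α → Matrix κ ι ℝ} (hN : MatMemLp N ∞ μ) {f : α → Vec ι}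
    (hf : MemLp f 2 μ) : MemLp (fun a => mv (N a) (f a)) 2 μ := by
  rw [memLp_piLp_iff]
  intro k
  simp only [mv_apply]
  refine memLp_finsetSum _ fun l _ => ?_
  exact MemLp.mul' (hf.eval_piLp l) (hN k l)

theorem memLp_mv_const {N : α → Matrix κ ι ℝ} (hN : MatMemLp N 2 μ) (v : Vec ι) :
    MemLp (fun a => mv (N a) v) 2 μ := by
  rw [memLp_piLp_iff]
  intro k
  simp only [mv_apply]
  refine memLp_finsetSum _ fun l _ => ?_
  exact (hN k l).mul_const _

theorem integrable_mv {N : α → Matrix κ ι ℝ} (hN : MatMemLp N 2 μ) {f : α → Vec ι}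
    (hf : MemLp f 2 μ) : Integrable (fun a => mv (N a) (f a)) μ := by
  rw [integrable_piLp_iff]
  intro k
  simp only [mv_apply]
  refine integrable_finsetSum _ fun l _ => ?_
  exact (hN k l).integrable_mul (hf.eval_piLp l)

variable {V : Type} [NormedAddCommGroup V] [NormedSpace ℝ V] [CompleteSpace V]

/-- The operator `e ↦ M[N] (G e)`, where `(M[N] f)(a) = N(a) f(a)`, for a matrix-valued function
`N` such that `M[N] (G e)` is square integrable for every `e`. It is bounded by the closed graph
theorem. -/
def mulComp (N : α → Matrix κ ι ℝ) (G : V →L[ℝ] Lp (Vec ι) 2 μ)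
    (h : ∀ e, MemLp (fun a => mv (N a) (G e a)) 2 μ) : V →L[ℝ] Lp (Vec κ) 2 μ :=
  ContinuousLinearMap.ofSeqClosedGraph
    (g := { toFun := fun e => (h e).toLp _
            map_add' := fun e e' => by
              rw [← MemLp.toLp_add, MemLp.toLp_eq_toLp_iff, map_add]
              filter_upwards [Lp.coeFn_add (G e) (G e')] with a ha
              rw [ha]
              exact mv_add _ _ _
            map_smul' := fun c e => by
              rw [RingHom.id_apply, ← MemLp.toLp_const_smul, MemLp.toLp_eq_toLp_iff, map_smul]
              filter_upwards [Lp.coeFn_smul c (G e)] with a ha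
              rw [ha]
              exact mv_smul _ _ _ })
    (by
      intro u e y hu hy
      have hG := (G.continuous.tendsto e).comp hu
      obtain ⟨s, hs, hs'⟩ := (tendstoInMeasure_of_tendsto_Lp hG).exists_seq_tendsto_ae
      obtain ⟨r, hr, hr'⟩ := (tendstoInMeasure_of_tendsto_Lp
        (hy.comp hs.tendsto_atTop)).exists_seq_tendsto_ae
      refine Lp.ext ?_
      have h1 : ∀ᵐ a ∂μ, ∀ n, (h (u n)).toLp _ a = mv (N a) (G (u n) a) :=
        ae_all_iff.2 fun n => (h (u n)).coeFn_toLp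
      filter_upwards [hs', hr', h1, (h e).coeFn_toLp] with a has har ha hae
      refine tendsto_nhds_unique har ?_
      change Filter.Tendsto _ _ (nhds ((h e).toLp _ a))
      rw [hae]
      have := (((continuous_mv (N a)).tendsto _).comp has).comp hr.tendsto_atTop
      refine this.congr fun n => ?_
      exact (ha _).symm)

/-- The multiplier operator `M[N]` on `L²`, `(M[N] f)(a) = N(a) f(a)`, for `N ∈ L^∞`. -/
def mulOp (N : α → Matrix κ ι ℝ) (hN : MatMemLp N ∞ μ) :
    Lp (Vec ι) 2 μ →L[ℝ] Lp (Vec κ) 2 μ :=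
  mulComp N (ContinuousLinearMap.id ℝ _) fun e => memLp_mv hN (Lp.memLp e)

/-- The multiplier operator `M[N] : ℝⁿ → L²`, `(M[N] v)(a) = N(a) v`, for `N ∈ L²`. -/
def vecMulOp (N : α → Matrix κ ι ℝ) (hN : MatMemLp N 2 μ) : Vec ι →L[ℝ] Lp (Vec κ) 2 μ :=
  LinearMap.toContinuousLinearMap
    { toFun := fun v => (memLp_mv_const hN v).toLp _
      map_add' := fun v w => by
        rw [← MemLp.toLp_add, MemLp.toLp_eq_toLp_iff]
        exact .of_forall fun a => by simp [mv_add]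
      map_smul' := fun c v => by
        rw [RingHom.id_apply, ← MemLp.toLp_const_smul, MemLp.toLp_eq_toLp_iff]
        exact .of_forall fun a => by simp [mv_smul] }

/-- The integral operator `∫[N] : L² → ℝᵐ`, `∫[N] f = ∫ N(a) f(a) da`, for `N ∈ L²`. -/
def intOp (N : α → Matrix κ ι ℝ) (hN : MatMemLp N 2 μ) : Lp (Vec ι) 2 μ →L[ℝ] Vec κ where
  toFun f := ∫ a, mv (N a) (f a) ∂μ
  map_add' f g := by
    rw [← integral_add (integrable_mv hN (Lp.memLp f)) (integrable_mv hN (Lp.memLp g))]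
    refine integral_congr_ae ?_
    filter_upwards [Lp.coeFn_add f g] with a ha
    rw [ha]
    exact mv_add _ _ _
  map_smul' c f := by
    rw [RingHom.id_apply, ← integral_smul]
    refine integral_congr_ae ?_
    filter_upwards [Lp.coeFn_smul c f] with a ha
    rw [ha]
    exact mv_smul _ _ _
  cont := by
    have hrow : ∀ k, MemLp (fun a => (WithLp.toLp 2 (N a k) : Vec ι)) 2 μ := fun k => by
      rw [memLp_piLp_iff]; exact fun l => hN k l
    have key : ∀ f : Lp (Vec ι) 2 μ, ∀ k,
        (∫ a, mv (N a) (f a) ∂μ) k = inner ℝ ((hrow k).toLp _) f := fun f k => by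
      rw [eval_integral_piLp fun k =>
        (integrable_piLp_iff.1 (integrable_mv hN (Lp.memLp f))) k, L2.inner_def]
      refine integral_congr_ae ?_
      filter_upwards [(hrow k).coeFn_toLp] with a ha
      rw [ha]
      simp [mv_apply, PiLp.inner_apply, mul_comm]
    refine (PiLp.continuous_toLp 2 (fun _ : κ => ℝ)).comp
      (f := fun f : Lp (Vec ι) 2 μ => fun k => (∫ a, mv (N a) (f a) ∂μ) k) ?_
    refine continuous_pi fun k => ?_
    simp only [key]
    fun_prop

end Multipliers

theorem matMemLp_const {α κ ι : Type} [MeasurableSpace α] {μ : Measure α} [IsFiniteMeasure μ]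
    (N : Matrix κ ι ℝ) (p : ℝ≥0∞) : MatMemLp (fun _ : α => N) p μ := fun _ _ => memLp_const _

/-! ### Integration in one variable, pullbacks -/

section Partial

variable {ι : Type} [Fintype ι]

theorem memLp_integral_snd {f : ℝ × ℝ → Vec ι} (hf : MemLp f 2 μS) :
    MemLp (fun x => ∫ y, f (x, y) ∂μI) 2 μI ∧
      eLpNorm (fun x => ∫ y, f (x, y) ∂μI) 2 μI ≤ eLpNorm f 2 μS := by
  have hm : AEStronglyMeasurable (fun x => ∫ y, f (x, y) ∂μI) μI :=
    hf.1.integral_prod_right'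
  have hle : eLpNorm (fun x => ∫ y, f (x, y) ∂μI) 2 μI ≤ eLpNorm f 2 μS := by
    rw [eLpNorm_eq_lintegral_rpow_enorm_toReal (by norm_num) (by norm_num),
      eLpNorm_eq_lintegral_rpow_enorm_toReal (by norm_num) (by norm_num)]
    refine ENNReal.rpow_le_rpow ?_ (by norm_num)
    rw [lintegral_prod _ (by have := hf.1.enorm; fun_prop)]
    refine lintegral_mono_ae ?_
    filter_upwards [hf.1.prodMk_left] with x hx
    have h1 : ‖∫ y, f (x, y) ∂μI‖ₑ ≤ eLpNorm (fun y => f (x, y)) 2 μI := by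
      refine (enorm_integral_le_lintegral_enorm _).trans ?_
      rw [← eLpNorm_one_eq_lintegral_enorm]
      exact eLpNorm_le_eLpNorm_of_exponent_le (by norm_num) hx
    rw [eLpNorm_eq_lintegral_rpow_enorm_toReal (by norm_num) (by norm_num)] at h1
    refine (ENNReal.rpow_le_rpow h1 (by norm_num)).trans ?_
    rw [← ENNReal.rpow_mul]
    norm_num
  exact ⟨⟨hm, hle.trans_lt hf.2⟩, hle⟩

/-- Integration in the second variable: `f ↦ (x ↦ ∫₀¹ f(x,y) dy)`. -/
def intY : L2S ι →L[ℝ] L2I ι :=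
  LinearMap.mkContinuous
    { toFun := fun f => (memLp_integral_snd (Lp.memLp f)).1.toLp _
      map_add' := fun f g => by
        rw [← MemLp.toLp_add, MemLp.toLp_eq_toLp_iff]
        filter_upwards [Measure.ae_ae_of_ae_prod (Lp.coeFn_add f g),
          ((Lp.memLp f).integrable (by norm_num)).prod_right_ae,
          ((Lp.memLp g).integrable (by norm_num)).prod_right_ae] with x hx hf hg
        rw [integral_congr_ae hx]
        exact integral_add hf hg
      map_smul' := fun c f => by
        rw [RingHom.id_apply, ← MemLp.toLp_const_smul, MemLp.toLp_eq_toLp_iff]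
        filter_upwards [Measure.ae_ae_of_ae_prod (Lp.coeFn_smul c f)] with x hx
        rw [integral_congr_ae hx]
        exact integral_smul c fun y => f (x, y) }
    1 (fun f => by
      rw [one_mul]
      change ‖(memLp_integral_snd (Lp.memLp f)).1.toLp _‖ ≤ _
      rw [Lp.norm_toLp, Lp.norm_def]
      exact ENNReal.toReal_mono (Lp.memLp f).2.ne (memLp_integral_snd (Lp.memLp f)).2)

/-- Interchange of the two variables: `f ↦ ((x,y) ↦ f(y,x))`. -/
def swapOp : L2S ι →L[ℝ] L2S ι :=
  (Lp.compMeasurePreservingₗᵢ ℝ Prod.swap Measure.measurePreserving_swap).toContinuousLinearMap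

/-- Integration in the first variable: `f ↦ (y ↦ ∫₀¹ f(x,y) dx)`. -/
def intX : L2S ι →L[ℝ] L2I ι := intY ∘L swapOp

/-- A function of `x` regarded as a function of `(x,y)`. -/
def pullFst : L2I ι →L[ℝ] L2S ι :=
  (Lp.compMeasurePreservingₗᵢ ℝ Prod.fst measurePreserving_fst).toContinuousLinearMap

/-- A function of `y` regarded as a function of `(x,y)`. -/
def pullSnd : L2I ι →L[ℝ] L2S ι :=
  (Lp.compMeasurePreservingₗᵢ ℝ Prod.snd measurePreserving_snd).toContinuousLinearMap

end Partial

/-! ### The Sobolev space `W₂` on `[0,1]²` -/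

/-- Partial derivative in `x` of a smooth function. -/
def dX (φ : ℝ × ℝ → ℝ) : ℝ × ℝ → ℝ := fun p => fderiv ℝ φ p (1, 0)

/-- Partial derivative in `y` of a smooth function. -/
def dY (φ : ℝ × ℝ → ℝ) : ℝ × ℝ → ℝ := fun p => fderiv ℝ φ p (0, 1)

/-- Test functions: smooth with compact support inside the open square `(0,1)²`. -/
structure IsTest (φ : ℝ × ℝ → ℝ) : Prop where
  smooth : ContDiff ℝ ∞ φ
  compact : HasCompactSupport φ
  supp : tsupport φ ⊆ Set.Ioo 0 1 ×ˢ Set.Ioo 0 1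

/-- `g = ∂ₓⁱ∂ᵧʲ f` on `(0,1)²` in the sense of weak derivatives. -/
def IsWeakDeriv {n : ℕ} (i j : ℕ) (f g : L2S (Fin n)) : Prop :=
  ∀ φ : ℝ × ℝ → ℝ, IsTest φ →
    ∫ p, (dX^[i] (dY^[j] φ)) p • f p ∂μS = (-1 : ℝ) ^ (i + j) • ∫ p, φ p • g p ∂μS

theorem contDiff_dX {φ : ℝ × ℝ → ℝ} (h : ContDiff ℝ ∞ φ) : ContDiff ℝ ∞ (dX φ) :=
  (h.fderiv_right (m := ∞) (by simp)).clm_apply contDiff_const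

theorem contDiff_dY {φ : ℝ × ℝ → ℝ} (h : ContDiff ℝ ∞ φ) : ContDiff ℝ ∞ (dY φ) :=
  (h.fderiv_right (m := ∞) (by simp)).clm_apply contDiff_const

theorem contDiff_iter {φ : ℝ × ℝ → ℝ} (h : ContDiff ℝ ∞ φ) (i j : ℕ) :
    ContDiff ℝ ∞ (dX^[i] (dY^[j] φ)) := by
  have h1 : ContDiff ℝ ∞ (dY^[j] φ) := by
    induction j with
    | zero => exact h
    | succ j ih => rw [Function.iterate_succ_apply']; exact contDiff_dY ih
  induction i with
  | zero => exact h1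
  | succ i ih => rw [Function.iterate_succ_apply']; exact contDiff_dX ih

/-- The scalar function `ψ`, regarded as a function with values in the scalar matrices. -/
def scal {α : Type} (n : ℕ) (ψ : α → ℝ) : α → Matrix (Fin n) (Fin n) ℝ := fun a => ψ a • 1

theorem mv_scal {α : Type} {n : ℕ} (ψ : α → ℝ) (a : α) (v : Vec (Fin n)) :
    mv (scal n ψ a) v = ψ a • v := by
  ext k
  simp [mv, scal, Matrix.smul_mulVec]

theorem ae_mem_S : ∀ᵐ p ∂μS, p ∈ Set.Icc (0 : ℝ) 1 ×ˢ Set.Icc (0 : ℝ) 1 := by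
  have h : μS = (volume.prod volume).restrict (Set.Icc (0 : ℝ) 1 ×ˢ Set.Icc (0 : ℝ) 1) :=
    Measure.prod_restrict _ _
  rw [h]
  exact ae_restrict_mem (measurableSet_Icc.prod measurableSet_Icc)

theorem scal_memLp_S (n : ℕ) {ψ : ℝ × ℝ → ℝ} (hψ : Continuous ψ) : MatMemLp (scal n ψ) ∞ μS := by
  intro k l
  obtain ⟨C, hC⟩ := (isCompact_Icc.prod isCompact_Icc).exists_bound_of_continuousOn
    (s := Set.Icc (0 : ℝ) 1 ×ˢ Set.Icc (0 : ℝ) 1) hψ.continuousOn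
  have : MemLp ψ ∞ μS := memLp_top_of_bound hψ.aestronglyMeasurable C (by
    filter_upwards [ae_mem_S] with p hp using hC p hp)
  simpa [scal] using this.mul_const ((1 : Matrix (Fin n) (Fin n) ℝ) k l)

theorem scal_memLp_I (n : ℕ) {ψ : ℝ → ℝ} (hψ : Continuous ψ) : MatMemLp (scal n ψ) ∞ μI := by
  intro k l
  obtain ⟨C, hC⟩ := isCompact_Icc.exists_bound_of_continuousOn
    (s := Set.Icc (0 : ℝ) 1) hψ.continuousOn
  have : MemLp ψ ∞ μI := memLp_top_of_bound hψ.aestronglyMeasurable C (by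
    filter_upwards [ae_restrict_mem measurableSet_Icc] with p hp using hC p hp)
  simpa [scal] using this.mul_const ((1 : Matrix (Fin n) (Fin n) ℝ) k l)

theorem MatMemLp.two {α κ ι : Type} [MeasurableSpace α] {μ : Measure α} [IsFiniteMeasure μ]
    {N : α → Matrix κ ι ℝ} (h : MatMemLp N ∞ μ) : MatMemLp N 2 μ :=
  fun k l => (h k l).mono_exponent le_top

/-- Families `(D i j)`, `0 ≤ i, j ≤ 2`, of `ℝⁿ`-valued square-integrable functions on `[0,1]²`. -/
abbrev Jet (n : ℕ) := Fin 3 → Fin 3 → L2S (Fin n)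

/-- The family `D` consists of the weak derivatives `D i j = ∂ₓⁱ∂ᵧʲ u` of `u = D 0 0`. -/
def IsJet {n : ℕ} (D : Jet n) : Prop :=
  ∀ i j : Fin 3, IsWeakDeriv i j (D 0 0) (D i j)

/-- The functional measuring the defect in the defining identity of a weak derivative. -/
def defect {n : ℕ} (φ : ℝ × ℝ → ℝ) (h : IsTest φ) (i j : Fin 3) : Jet n →L[ℝ] Vec (Fin n) :=
  intOp _ (scal_memLp_S n (contDiff_iter h.smooth i j).continuous).two ∘L
      (ContinuousLinearMap.proj 0 ∘L ContinuousLinearMap.proj 0) -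
    (-1 : ℝ) ^ ((i : ℕ) + (j : ℕ)) • (intOp _ (scal_memLp_S n h.smooth.continuous).two ∘L
      (ContinuousLinearMap.proj j ∘L ContinuousLinearMap.proj i))

theorem isJet_iff {n : ℕ} (D : Jet n) :
    IsJet D ↔ ∀ (i j : Fin 3) (φ : ℝ × ℝ → ℝ) (h : IsTest φ), defect φ h i j D = 0 := by
  refine forall_congr' fun i => forall_congr' fun j => forall_congr' fun φ =>
    forall_congr' fun h => ?_
  rw [← sub_eq_zero]
  simp only [defect, intOp, sub_apply, smul_apply,
    ContinuousLinearMap.comp_apply, ContinuousLinearMap.proj_apply]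
  change _ ↔ (∫ p, mv _ _ ∂μS) - _ • (∫ p, mv _ _ ∂μS) = 0
  simp only [mv_scal]

/-- The Sobolev space `W₂ⁿ[[0,1]²]` of all `u ∈ L²` whose weak derivatives `∂ₓⁱ∂ᵧʲ u`, `i, j ≤ 2`,
lie in `L²`. An element is the family `D` of these derivatives; it is determined by `u = D 0 0`. -/
def W2 (n : ℕ) : Submodule ℝ (Jet n) where
  carrier := {D | IsJet D}
  add_mem' {a b} ha hb := by
    simp only [Set.mem_ofPred_eq, isJet_iff] at *
    intro i j φ h
    rw [map_add, ha, hb, add_zero]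
  zero_mem' := by
    simp only [Set.mem_ofPred_eq, isJet_iff]
    intro i j φ h
    exact map_zero _
  smul_mem' c a ha := by
    simp only [Set.mem_ofPred_eq, isJet_iff] at *
    intro i j φ h
    rw [map_smul, ha, smul_zero]

theorem isClosed_W2 (n : ℕ) : IsClosed (W2 n : Set (Jet n)) := by
  have : (W2 n : Set (Jet n)) = ⋂ (i : Fin 3) (j : Fin 3) (φ : ℝ × ℝ → ℝ) (h : IsTest φ),
      {D | defect φ h i j D = 0} := by
    ext D
    simp only [Set.mem_iInter, Set.mem_ofPred_eq]
    exact isJet_iff D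
  rw [this]
  exact isClosed_iInter fun i => isClosed_iInter fun j => isClosed_iInter fun φ =>
    isClosed_iInter fun h => isClosed_eq (ContinuousLinearMap.continuous _) continuous_const

/-- `∂ₓⁱ∂ᵧʲ`, as a map on jets. -/
def deriv2 {n : ℕ} (i j : Fin 3) : Jet n →L[ℝ] L2S (Fin n) :=
  ContinuousLinearMap.proj j ∘L ContinuousLinearMap.proj i

/-! ### Boundary values

If `h ∈ L²[0,1]` has weak derivative `h' ∈ L²[0,1]`, then `h` is absolutely continuous and
`∫₀¹ (h(s) + (s + a - 1) h'(s)) ds = [(s + a - 1) h(s)]₀¹ = a h(1) + (1 - a) h(0)`.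
For `a ∈ {0,1}` this is the boundary value `h(a)`; it is applied to one variable at a time. -/

/-- The weight `s + a - 1` in the formula for the boundary value at `a ∈ {0,1}`. -/
def wt (a : Fin 2) (s : ℝ) : ℝ := s + ((a : ℕ) : ℝ) - 1

theorem continuous_wt (a : Fin 2) : Continuous (wt a) := by unfold wt; fun_prop

/-- `Δ_y^b ∂ₓⁱ∂ᵧʲ u`: the boundary value of `y ↦ ∂ₓⁱ∂ᵧʲ u(x,y)` at `y = b`, a function of `x`. -/
def deltaY {n : ℕ} (b : Fin 2) (i : Fin 3) (j : Fin 2) : Jet n →L[ℝ] L2I (Fin n) :=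
  intY ∘L (deriv2 i j.castSucc +
    mulOp (scal n fun p : ℝ × ℝ => wt b p.2)
      (scal_memLp_S n ((continuous_wt b).comp continuous_snd)) ∘L deriv2 i j.succ)

/-- `Δ_x^a ∂ₓⁱ∂ᵧʲ u`: the boundary value of `x ↦ ∂ₓⁱ∂ᵧʲ u(x,y)` at `x = a`, a function of `y`. -/
def deltaX {n : ℕ} (a : Fin 2) (i : Fin 2) (j : Fin 3) : Jet n →L[ℝ] L2I (Fin n) :=
  intX ∘L (deriv2 i.castSucc j +
    mulOp (scal n fun p : ℝ × ℝ => wt a p.1)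
      (scal_memLp_S n ((continuous_wt a).comp continuous_fst)) ∘L deriv2 i.succ j)

/-- The corner value `Δ_x^a Δ_y^b ∂ₓⁱ∂ᵧʲ u = (∂ₓⁱ∂ᵧʲ u)(a,b)`: the boundary value at `x = a` of
`x ↦ (Δ_y^b ∂ₓⁱ∂ᵧʲ u)(x)`, whose derivative is `Δ_y^b ∂ₓⁱ⁺¹∂ᵧʲ u`. -/
def deltaXY {n : ℕ} (a b : Fin 2) (i j : Fin 2) : Jet n →L[ℝ] Vec (Fin n) :=
  intOp (fun _ : ℝ => (1 : Matrix (Fin n) (Fin n) ℝ)) (matMemLp_const _ _) ∘L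
      deltaY b i.castSucc j +
    intOp (scal n (wt a)) (scal_memLp_I n (continuous_wt a)).two ∘L deltaY b i.succ j

/-- Indices of the `16 n` corner values: `((i, j, a, b), k)` stands for `(∂ₓⁱ∂ᵧʲ uₖ)(a,b)`. -/
abbrev CornerIdx (n : ℕ) := (Fin 2 × Fin 2 × Fin 2 × Fin 2) × Fin n

/-- Indices of the `4 n` boundary functions on a pair of opposite edges: `((j, b), k)` stands for
`x ↦ ∂ₓ²∂ᵧʲ uₖ(x,b)` on the edges `y = b`, and for `y ↦ ∂ₓʲ∂ᵧ² uₖ(b,y)` on the edges `x = b`. -/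
abbrev EdgeIdx (n : ℕ) := (Fin 2 × Fin 2) × Fin n

/-- The matrix embedding `ℝⁿ` as the block `s` of `ℝ^(σ × n)`. -/
def blk {σ : Type} [DecidableEq σ] (n : ℕ) (s : σ) : Matrix (σ × Fin n) (Fin n) ℝ :=
  Matrix.of fun p k => if p.1 = s ∧ p.2 = k then 1 else 0

/-- `Λ₁ u`: the component `((i,j,a,b),k)` is `(∂ₓⁱ∂ᵧʲ uₖ)(a,b)`. -/
def Lam1 {n : ℕ} : Jet n →L[ℝ] Vec (CornerIdx n) :=
  ∑ s : Fin 2 × Fin 2 × Fin 2 × Fin 2,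
    mvL (blk n s) ∘L deltaXY s.2.2.1 s.2.2.2 s.1 s.2.1

/-- `Λ₂ u`: the component `((j,b),k)` is the function `x ↦ ∂ₓ²∂ᵧʲ uₖ(x,b)`. -/
def Lam2 {n : ℕ} : Jet n →L[ℝ] L2I (EdgeIdx n) :=
  ∑ s : Fin 2 × Fin 2,
    mulOp (fun _ : ℝ => blk n s) (matMemLp_const _ _) ∘L deltaY s.2 2 s.1

/-- `Λ₃ u`: the component `((i,a),k)` is the function `y ↦ ∂ₓⁱ∂ᵧ² uₖ(a,y)`. -/
def Lam3 {n : ℕ} : Jet n →L[ℝ] L2I (EdgeIdx n) :=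
  ∑ s : Fin 2 × Fin 2,
    mulOp (fun _ : ℝ => blk n s) (matMemLp_const _ _) ∘L deltaX s.2 s.1 2

/-- Matrices `E` with `8 n` rows and `24 n` columns defining boundary conditions. -/
abbrev BCMatrix (n : ℕ) := Matrix (Fin (8 * n)) (CornerIdx n ⊕ EdgeIdx n ⊕ EdgeIdx n) ℝ

/-- `M[E] Λ_bf u` with `Λ_bf u = (Λ₁ u, Λ₂ u, Λ₃ u)`: the function `(x,y) ↦ E (Λ₁ u, (Λ₂ u)(x), (Λ₃ u)(y))` with values in `ℝ^(8n)`. -/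
def bcOp {n : ℕ} (E : BCMatrix n) : Jet n →L[ℝ] L2S (Fin (8 * n)) :=
  vecMulOp (fun _ : ℝ × ℝ => E.submatrix id Sum.inl) (matMemLp_const _ _) ∘L Lam1 +
  mulOp (fun _ : ℝ × ℝ => E.submatrix id (Sum.inr ∘ Sum.inl)) (matMemLp_const _ _) ∘L
    pullFst ∘L Lam2 +
  mulOp (fun _ : ℝ × ℝ => E.submatrix id (Sum.inr ∘ Sum.inr)) (matMemLp_const _ _) ∘L
    pullSnd ∘L Lam3

/-- The domain `X = {u ∈ W₂ | M[E] Λ_bf u = 0}` of the PDE. -/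
def bcSpace {n : ℕ} (E : BCMatrix n) : Submodule ℝ (Jet n) :=
  W2 n ⊓ (bcOp E).ker

instance instCompleteBC {n : ℕ} (E : BCMatrix n) : CompleteSpace (bcSpace E) := by
  have : IsClosed (bcSpace E : Set (Jet n)) :=
    (isClosed_W2 n).inter (ContinuousLinearMap.isClosed_ker (bcOp E))
  exact this.completeSpace_coe

/-- The map `u ↦ ∂ₓ²∂ᵧ² u` from `X` to `L²`, sending a state to its fundamental state. -/
def fundState {n : ℕ} (E : BCMatrix n) : bcSpace E →L[ℝ] L2S (Fin n) :=
  deriv2 2 2 ∘L (bcSpace E).subtypeL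

/-- The boundary conditions are well-posed: every `v ∈ L²` equals `∂ₓ²∂ᵧ² u` for exactly one
`u ∈ X`. -/
def WellPosed {n : ℕ} (E : BCMatrix n) : Prop := Function.Bijective (fundState E)

/-- The inverse of `∂ₓ²∂ᵧ² : X → L²` for well-posed boundary conditions. -/
def solOp {n : ℕ} (E : BCMatrix n) (hE : WellPosed E) : L2S (Fin n) →L[ℝ] bcSpace E :=
  (ContinuousLinearEquiv.ofBijective (fundState E)
    (LinearMap.ker_eq_bot.2 hE.1) (LinearMap.range_eq_top.2 hE.2)).symm.toContinuousLinearMap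

/-! ### The PDE, its outputs, and the associated operators -/

/-- The parameters of a second-order 2D PDE with regulated output `z` and observed outputs
`q₁, q₂, q₃`. -/
structure PDEData (nu nw nz nq1 nq2 nq3 : ℕ) where
  /-- The coefficient of `∂ₓⁱ∂ᵧʲ u` in the dynamics. -/
  A : Fin 3 → Fin 3 → ℝ × ℝ → Matrix (Fin nu) (Fin nu) ℝ
  hA : ∀ i j, MatMemLp (A i j) ∞ μS
  /-- The weight of the disturbance in the dynamics. -/
  B : ℝ × ℝ → Matrix (Fin nu) (Fin nw) ℝ
  hB : MatMemLp B 2 μS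
  /-- The weight of `∂ₓⁱ∂ᵧʲ u` in the regulated output. -/
  C : Fin 3 → Fin 3 → ℝ × ℝ → Matrix (Fin nz) (Fin nu) ℝ
  hC : ∀ i j, MatMemLp (C i j) 2 μS
  /-- The weight of the disturbance in the regulated output. -/
  D : Matrix (Fin nz) (Fin nw) ℝ
  /-- The boundary conditions are `M[E] Λ_bf u = 0`. -/
  E : BCMatrix nu
  /-- The observed outputs are `qₖ = M[Cₖ] Λₖ u + M[Dₖ] w` for `k = 1, 2, 3`. -/
  C1 : Matrix (Fin nq1) (CornerIdx nu) ℝ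
  C2 : ℝ → Matrix (Fin nq2) (EdgeIdx nu) ℝ
  hC2 : MatMemLp C2 2 μI
  C3 : ℝ → Matrix (Fin nq3) (EdgeIdx nu) ℝ
  hC3 : MatMemLp C3 2 μI
  D1 : Matrix (Fin nq1) (Fin nw) ℝ
  D2 : ℝ → Matrix (Fin nq2) (Fin nw) ℝ
  hD2 : MatMemLp D2 2 μI
  D3 : ℝ → Matrix (Fin nq3) (Fin nw) ℝ
  hD3 : MatMemLp D3 2 μI
  /-- `q₂` and `q₃` take values in `L²`; this is automatic for bounded `C2`, `C3`. -/
  hq2 : ∀ u : bcSpace E, MemLp (fun x => mv (C2 x) (Lam2 (u : Jet nu) x)) 2 μI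
  hq3 : ∀ u : bcSpace E, MemLp (fun y => mv (C3 y) (Lam3 (u : Jet nu) y)) 2 μI

namespace PDEData

variable {nu nw nz nq1 nq2 nq3 : ℕ} (G : PDEData nu nw nz nq1 nq2 nq3)

/-- The state space `X`. -/
abbrev X := bcSpace G.E

/-- The state `u ∈ X` as an element of `L²`. -/
def toL2 : G.X →L[ℝ] L2S (Fin nu) := deriv2 0 0 ∘L (bcSpace G.E).subtypeL

/-- `u ↦ ∑ᵢⱼ M[Aᵢⱼ] ∂ₓⁱ∂ᵧʲ u`. -/
def dynOp : G.X →L[ℝ] L2S (Fin nu) :=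
  (∑ i, ∑ j, mulOp (G.A i j) (G.hA i j) ∘L deriv2 i j) ∘L (bcSpace G.E).subtypeL

/-- `u ↦ ∑ᵢⱼ ∫[Cᵢⱼ] ∂ₓⁱ∂ᵧʲ u`. -/
def outOp : G.X →L[ℝ] Vec (Fin nz) :=
  (∑ i, ∑ j, intOp (G.C i j) (G.hC i j) ∘L deriv2 i j) ∘L (bcSpace G.E).subtypeL

/-- `u ↦ M[C₁] Λ₁ u`. -/
def obsOp1 : G.X →L[ℝ] Vec (Fin nq1) := mvL G.C1 ∘L Lam1 ∘L (bcSpace G.E).subtypeL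

/-- `u ↦ M[C₂] Λ₂ u`. -/
def obsOp2 : G.X →L[ℝ] L2I (Fin nq2) := mulComp G.C2 (Lam2 ∘L (bcSpace G.E).subtypeL) G.hq2

/-- `u ↦ M[C₃] Λ₃ u`. -/
def obsOp3 : G.X →L[ℝ] L2I (Fin nq3) := mulComp G.C3 (Lam3 ∘L (bcSpace G.E).subtypeL) G.hq3

/-- `(u, z, q)` with `q = (q₁, q₂, q₃)` solves the PDE with disturbance `w` and initial state `u₀`
on the time axis `t ≥ 0`: `u(t) ∈ X`, the map `u` is differentiable into `L²`, and the dynamics and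
output equations hold at every time. -/
structure IsSolution (w : ℝ → Vec (Fin nw)) (u₀ : G.X) (u : ℝ → G.X) (z : ℝ → Vec (Fin nz))
    (q₁ : ℝ → Vec (Fin nq1)) (q₂ : ℝ → L2I (Fin nq2)) (q₃ : ℝ → L2I (Fin nq3)) : Prop where
  init : u 0 = u₀
  dyn : ∀ t, 0 ≤ t → HasDerivWithinAt (fun s => G.toL2 (u s))
    (G.dynOp (u t) + vecMulOp G.B G.hB (w t)) (Set.Ici 0) t
  out : ∀ t, 0 ≤ t → z t = G.outOp (u t) + mvL G.D (w t)
  obs1 : ∀ t, 0 ≤ t → q₁ t = G.obsOp1 (u t) + mvL G.D1 (w t)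
  obs2 : ∀ t, 0 ≤ t → q₂ t = G.obsOp2 (u t) + vecMulOp G.D2 G.hD2 (w t)
  obs3 : ∀ t, 0 ≤ t → q₃ t = G.obsOp3 (u t) + vecMulOp G.D3 G.hD3 (w t)

/-! The operators of the associated PIE, for well-posed boundary conditions: each operator of the
PDE is composed with the inverse of `∂ₓ²∂ᵧ² : X → L²`. -/

variable (hG : WellPosed G.E)

/-- `𝒯`, with `𝒯 ∂ₓ²∂ᵧ² u = u` for `u ∈ X`, and `𝒯 v ∈ X`, `∂ₓ²∂ᵧ² 𝒯 v = v` for `v ∈ L²`. -/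
def opT : L2S (Fin nu) →L[ℝ] L2S (Fin nu) := G.toL2 ∘L solOp G.E hG

/-- `𝒜 = ∑ᵢⱼ M[Aᵢⱼ] ∂ₓⁱ∂ᵧʲ 𝒯`. -/
def opA : L2S (Fin nu) →L[ℝ] L2S (Fin nu) := G.dynOp ∘L solOp G.E hG

/-- `ℬ = M[B]`. -/
def opB : Vec (Fin nw) →L[ℝ] L2S (Fin nu) := vecMulOp G.B G.hB

/-- `𝒞 = ∑ᵢⱼ ∫[Cᵢⱼ] ∂ₓⁱ∂ᵧʲ 𝒯`. -/
def opC : L2S (Fin nu) →L[ℝ] Vec (Fin nz) := G.outOp ∘L solOp G.E hG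

/-- `𝒟 = M[D]`. -/
def opD : Vec (Fin nw) →L[ℝ] Vec (Fin nz) := mvL G.D

/-- `𝒞₁ = M[C₁] Λ₁ 𝒯`, the first component of `𝒞_q`. -/
def opC1 : L2S (Fin nu) →L[ℝ] Vec (Fin nq1) := G.obsOp1 ∘L solOp G.E hG

/-- `𝒞₂ = M[C₂] Λ₂ 𝒯`, the second component of `𝒞_q`. -/
def opC2 : L2S (Fin nu) →L[ℝ] L2I (Fin nq2) := G.obsOp2 ∘L solOp G.E hG

/-- `𝒞₃ = M[C₃] Λ₃ 𝒯`, the third component of `𝒞_q`. -/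
def opC3 : L2S (Fin nu) →L[ℝ] L2I (Fin nq3) := G.obsOp3 ∘L solOp G.E hG

/-- `M[D₁]`, the first component of `𝒟_q`. -/
def opD1 : Vec (Fin nw) →L[ℝ] Vec (Fin nq1) := mvL G.D1

/-- `M[D₂]`, the second component of `𝒟_q`. -/
def opD2 : Vec (Fin nw) →L[ℝ] L2I (Fin nq2) := vecMulOp G.D2 G.hD2

/-- `M[D₃]`, the third component of `𝒟_q`. -/
def opD3 : Vec (Fin nw) →L[ℝ] L2I (Fin nq3) := vecMulOp G.D3 G.hD3

end PDEData

/-! ### Partial integral (PI) operators -/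

/-- `R` is a 2D PI operator: it is bounded and is given by the PI formula with square-integrable
parameters. -/
def IsPI2D {m n : ℕ} (R : L2S (Fin n) →L[ℝ] L2S (Fin m)) : Prop :=
  ∃ (R00 : ℝ × ℝ → Matrix (Fin m) (Fin n) ℝ)
    (R10 R20 R01 R02 : (ℝ × ℝ) × ℝ → Matrix (Fin m) (Fin n) ℝ)
    (R11 R21 R12 R22 : (ℝ × ℝ) × (ℝ × ℝ) → Matrix (Fin m) (Fin n) ℝ),
    MatMemLp R00 2 μS ∧
    (MatMemLp R10 2 (μS.prod μI) ∧ MatMemLp R20 2 (μS.prod μI) ∧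
      MatMemLp R01 2 (μS.prod μI) ∧ MatMemLp R02 2 (μS.prod μI)) ∧
    (MatMemLp R11 2 (μS.prod μS) ∧ MatMemLp R21 2 (μS.prod μS) ∧
      MatMemLp R12 2 (μS.prod μS) ∧ MatMemLp R22 2 (μS.prod μS)) ∧
    ∀ v : L2S (Fin n), ∀ᵐ p ∂μS, R v p =
      mv (R00 p) (v p)
      + (∫ θ in (0 : ℝ)..p.1, mv (R10 (p, θ)) (v (θ, p.2)))
      + (∫ θ in p.1..(1 : ℝ), mv (R20 (p, θ)) (v (θ, p.2)))
      + (∫ η in (0 : ℝ)..p.2, mv (R01 (p, η)) (v (p.1, η)))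
      + (∫ η in p.2..(1 : ℝ), mv (R02 (p, η)) (v (p.1, η)))
      + (∫ θ in (0 : ℝ)..p.1, ∫ η in (0 : ℝ)..p.2, mv (R11 (p, (θ, η))) (v (θ, η)))
      + (∫ θ in p.1..(1 : ℝ), ∫ η in (0 : ℝ)..p.2, mv (R21 (p, (θ, η))) (v (θ, η)))
      + (∫ θ in (0 : ℝ)..p.1, ∫ η in p.2..(1 : ℝ), mv (R12 (p, (θ, η))) (v (θ, η)))
      + (∫ θ in p.1..(1 : ℝ), ∫ η in p.2..(1 : ℝ), mv (R22 (p, (θ, η))) (v (θ, η)))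

/-- `Q` is a PI operator from functions on `[0,1]` to functions on `[0,1]²`, the variable on `[0,1]`
being identified with `x` (first alternative) or with `y` (second alternative). -/
def IsPI2D1D {m n : ℕ} (Q : L2I (Fin n) →L[ℝ] L2S (Fin m)) : Prop :=
  ∃ (Q0 : ℝ × ℝ → Matrix (Fin m) (Fin n) ℝ) (Q1 Q2 : (ℝ × ℝ) × ℝ → Matrix (Fin m) (Fin n) ℝ),
    MatMemLp Q0 2 μS ∧ MatMemLp Q1 2 (μS.prod μI) ∧ MatMemLp Q2 2 (μS.prod μI) ∧
    ((∀ f : L2I (Fin n), ∀ᵐ p ∂μS, Q f p =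
        mv (Q0 p) (f p.1) + (∫ θ in (0 : ℝ)..p.1, mv (Q1 (p, θ)) (f θ))
          + (∫ θ in p.1..(1 : ℝ), mv (Q2 (p, θ)) (f θ))) ∨
      (∀ f : L2I (Fin n), ∀ᵐ p ∂μS, Q f p =
        mv (Q0 p) (f p.2) + (∫ η in (0 : ℝ)..p.2, mv (Q1 (p, η)) (f η))
          + (∫ η in p.2..(1 : ℝ), mv (Q2 (p, η)) (f η))))

/-- `Q` is a PI operator from `ℝⁿ` to functions on `[0,1]²`, that is, `Q = M[K]` with `K ∈ L²`. -/
def IsPI2D0 {m n : ℕ} (Q : Vec (Fin n) →L[ℝ] L2S (Fin m)) : Prop :=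
  ∃ (K : ℝ × ℝ → Matrix (Fin m) (Fin n) ℝ) (hK : MatMemLp K 2 μS), Q = vecMulOp K hK

/-! ### The linear PI inequality and the estimator -/

section LPI

variable {H₁ H₂ H₃ : Type} [NormedAddCommGroup H₁] [InnerProductSpace ℝ H₁] [CompleteSpace H₁]
  [NormedAddCommGroup H₂] [InnerProductSpace ℝ H₂] [CompleteSpace H₂]
  [NormedAddCommGroup H₃] [InnerProductSpace ℝ H₃] [CompleteSpace H₃]

/-- `P = P* ≻ 0`: the bounded operator `P` is self-adjoint and coercive. -/
def IsPosDefOp (P : H₁ →L[ℝ] H₁) : Prop :=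
  IsSelfAdjoint P ∧ ∃ ε > 0, ∀ v, ε * ‖v‖ ^ 2 ≤ inner ℝ v (P v)

/-- The symmetric block operator on `H₁ × H₂ × H₃` with upper triangular blocks `Qᵢⱼ`, `i ≤ j`, and
lower triangular blocks `Qᵢⱼ*` is negative semidefinite. -/
def BlockNonpos (Q₁₁ : H₁ →L[ℝ] H₁) (Q₁₂ : H₂ →L[ℝ] H₁) (Q₁₃ : H₃ →L[ℝ] H₁)
    (Q₂₂ : H₂ →L[ℝ] H₂) (Q₂₃ : H₃ →L[ℝ] H₂) (Q₃₃ : H₃ →L[ℝ] H₃) : Prop :=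
  ∀ (a : H₁) (b : H₂) (c : H₃),
    inner ℝ a (Q₁₁ a + Q₁₂ b + Q₁₃ c)
    + inner ℝ b (Q₁₂.adjoint a + Q₂₂ b + Q₂₃ c)
    + inner ℝ c (Q₁₃.adjoint a + Q₂₃.adjoint b + Q₃₃ c) ≤ 0

end LPI

namespace PDEData

variable {nu nw nz nq1 nq2 nq3 : ℕ} (G : PDEData nu nw nz nq1 nq2 nq3) (hG : WellPosed G.E)

/-- The linear PI inequality
```
[ -γ I    -𝒟      𝒞                          ]
[ (·)*    -γ I    -[ℬ*P + 𝒟_q* W*] 𝒯         ]  ⪯ 0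
[ (·)*    (·)*    (·)* + 𝒯*[P 𝒜 + W 𝒞_q]     ]
```
where `W = [W₁ W₂ W₃]`, `𝒞_q = (𝒞₁, 𝒞₂, 𝒞₃)` and `𝒟_q = (M[D₁], M[D₂], M[D₃])`. -/
def LPI (γ : ℝ) (P : L2S (Fin nu) →L[ℝ] L2S (Fin nu)) (W₁ : Vec (Fin nq1) →L[ℝ] L2S (Fin nu))
    (W₂ : L2I (Fin nq2) →L[ℝ] L2S (Fin nu)) (W₃ : L2I (Fin nq3) →L[ℝ] L2S (Fin nu)) : Prop :=
  let S := (G.opT hG).adjoint ∘L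
    (P ∘L G.opA hG + (W₁ ∘L G.opC1 hG + W₂ ∘L G.opC2 hG + W₃ ∘L G.opC3 hG))
  BlockNonpos
    (-(γ • ContinuousLinearMap.id ℝ (Vec (Fin nz))))
    (-G.opD)
    (G.opC hG)
    (-(γ • ContinuousLinearMap.id ℝ (Vec (Fin nw))))
    (-((G.opB.adjoint ∘L P + (G.opD1.adjoint ∘L W₁.adjoint + G.opD2.adjoint ∘L W₂.adjoint
      + G.opD3.adjoint ∘L W₃.adjoint)) ∘L G.opT hG))
    (S.adjoint + S)

/-- `(v̂, ẑ)` solves the Luenberger-type estimator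
`𝒯 v̂ₜ = 𝒜 v̂ + ℒ (𝒞_q v̂ - q)`, `ẑ = 𝒞 v̂` with gain `ℒ = [L₁ L₂ L₃]`, input `q = (q₁, q₂, q₃)` and
initial state `v₀`: the map `v̂` is differentiable into `L²` and the equations hold at every
time `t ≥ 0`. -/
structure IsEstimator (L₁ : Vec (Fin nq1) →L[ℝ] L2S (Fin nu))
    (L₂ : L2I (Fin nq2) →L[ℝ] L2S (Fin nu)) (L₃ : L2I (Fin nq3) →L[ℝ] L2S (Fin nu))
    (q₁ : ℝ → Vec (Fin nq1)) (q₂ : ℝ → L2I (Fin nq2)) (q₃ : ℝ → L2I (Fin nq3))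
    (v₀ : L2S (Fin nu)) (v : ℝ → L2S (Fin nu)) (z : ℝ → Vec (Fin nz)) : Prop where
  init : v 0 = v₀
  dyn : ∀ t, 0 ≤ t → ∃ v', HasDerivWithinAt v v' (Set.Ici 0) t ∧
    G.opT hG v' = G.opA hG (v t) + (L₁ (G.opC1 hG (v t) - q₁ t) + L₂ (G.opC2 hG (v t) - q₂ t)
      + L₃ (G.opC3 hG (v t) - q₃ t))
  out : ∀ t, 0 ≤ t → z t = G.opC hG (v t)

end PDEData

end

end PIE2D

open PIE2D

/-!
Let `v̂` be the state of the estimator, `v = ∂ₓ²∂ᵧ² u` the fundamental state of the PDE, and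
`e = v̂ - v`. Since `𝒯 v = u`, `𝒜 v = ∑ M[Aᵢⱼ] ∂ₓⁱ∂ᵧʲ u` and so on, subtracting the two systems gives
`(𝒯 e)ₜ = 𝒜 e - ℬ w + P⁻¹ W (𝒞_q e - 𝒟_q w)`, `𝒯 e(0) = 0`, and `ζ := ẑ - z = 𝒞 e - 𝒟 w`. The
storage function `V = γ ⟪𝒯 e, P 𝒯 e⟫` is nonnegative, vanishes at time `0`, and satisfies
`V' + ‖ζ‖² ≤ γ² ‖w‖²`: this is `γ` times the linear PI inequality evaluated at `(γ⁻¹ ζ, w, e)`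
(`PDEData.LPI.dissipation`), where `P P⁻¹ = 1` by the Lax-Milgram theorem
(`IsPosDefOp.apply_inverse`). Integration over `[0, n]` and `n → ∞` give the claim.

Two points of regularity need care. First, `V` is differentiable at every time, but neither `V'` nor
`‖ζ‖²` is known to be integrable; `‖ζ‖²` is therefore truncated at height `n` before integrating
over `[0, n]`, and Fatou's lemma removes the truncation (`eLpNorm_le_of_dissipation`). Second, `ζ`
involves `u(t)` as an element of `X`, whereas only continuity of `u` into `L²` is given.
Measurability of `ζ` follows from the injectivity of `X → L²`, which is the uniqueness of weak
derivatives, and the Lusin-Souslin theorem (`PDEData.IsSolution.aestronglyMeasurable_comp`).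
-/

namespace PIE2D

open Set Filter Topology

/-! ### Dissipation inequalities on the half line -/

section Dissipation

variable {E F : Type*} [NormedAddCommGroup E] [NormedAddCommGroup F]

/-- The integrated dissipation inequality on `[0, n]`, with `‖ζ‖²` truncated at height `n` so that
the upper bound `γ² ‖w‖² - min ‖ζ‖² n` for `V'` is integrable. -/
theorem setLIntegral_truncation_le {γ : ℝ} {V V' : ℝ → ℝ} {w : ℝ → E} {ζ : ℝ → F}
    (hV0 : V 0 = 0) (hVnonneg : ∀ t, 0 ≤ t → 0 ≤ V t)
    (hV : ∀ t, 0 ≤ t → HasDerivWithinAt V (V' t) (Ici 0) t)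
    (hdis : ∀ t, 0 ≤ t → V' t + ‖ζ t‖ ^ 2 ≤ γ ^ 2 * ‖w t‖ ^ 2)
    (hw : MemLp w 2 μT) (hζ : AEStronglyMeasurable ζ μT) (n : ℕ) :
    ∫⁻ t in Icc (0 : ℝ) n, ENNReal.ofReal (min (‖ζ t‖ ^ 2) n) ≤
      ∫⁻ t, ENNReal.ofReal (γ ^ 2 * ‖w t‖ ^ 2) ∂μT := by
  have hn : (0 : ℝ) ≤ n := n.cast_nonneg
  have hsub : Icc (0 : ℝ) n ⊆ Ici 0 := Icc_subset_Ici_self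
  have hwi : IntegrableOn (fun t => γ ^ 2 * ‖w t‖ ^ 2) (Icc (0 : ℝ) n) :=
    IntegrableOn.mono_set ((hw.integrable_norm_pow (by norm_num)).const_mul _) hsub
  have hgi : IntegrableOn (fun t => min (‖ζ t‖ ^ 2) (n : ℝ)) (Icc (0 : ℝ) n) := by
    refine Integrable.of_bound
      (((hζ.mono_set hsub).norm.pow 2).inf aestronglyMeasurable_const) n (.of_forall fun t => ?_)
    rw [Real.norm_of_nonneg (by positivity)]
    exact min_le_right _ _
  have key : V n - V 0 ≤ ∫ t in (0 : ℝ)..n, (γ ^ 2 * ‖w t‖ ^ 2 - min (‖ζ t‖ ^ 2) (n : ℝ)) := by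
    refine intervalIntegral.sub_le_integral_of_hasDeriv_right_of_le (g' := V') hn
      (fun t ht => ((hV t ht.1).mono hsub).continuousWithinAt)
      (fun t ht => (hV t ht.1.le).mono fun s hs => ht.1.le.trans (le_of_lt hs))
      (hwi.sub hgi) fun t ht => ?_
    have h1 := hdis t ht.1.le
    have h2 := min_le_left (‖ζ t‖ ^ 2) (n : ℝ)
    linarith
  rw [intervalIntegral.integral_of_le hn, ← integral_Icc_eq_integral_Ioc,
    integral_sub hwi hgi, hV0, sub_zero] at key
  have h := hVnonneg n hn
  rw [← ofReal_integral_eq_lintegral_ofReal hgi (.of_forall fun t => by positivity)]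
  refine (ENNReal.ofReal_le_ofReal
    (show _ ≤ ∫ t in Icc (0 : ℝ) n, γ ^ 2 * ‖w t‖ ^ 2 by linarith)).trans ?_
  rw [ofReal_integral_eq_lintegral_ofReal hwi (.of_forall fun t => by positivity)]
  exact lintegral_mono_set hsub

/-- A nonnegative storage function `V` that vanishes initially and satisfies the dissipation
inequality `V' + ‖ζ‖² ≤ γ² ‖w‖²` gives the gain bound `‖ζ‖_{L²} ≤ γ ‖w‖_{L²}`. Integrability of
`V'` is not assumed. -/
theorem eLpNorm_le_of_dissipation [NormedSpace ℝ E] {γ : ℝ} (hγ : 0 ≤ γ)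
    {V V' : ℝ → ℝ} {w : ℝ → E} {ζ : ℝ → F}
    (hV0 : V 0 = 0) (hVnonneg : ∀ t, 0 ≤ t → 0 ≤ V t)
    (hV : ∀ t, 0 ≤ t → HasDerivWithinAt V (V' t) (Ici 0) t)
    (hdis : ∀ t, 0 ≤ t → V' t + ‖ζ t‖ ^ 2 ≤ γ ^ 2 * ‖w t‖ ^ 2)
    (hw : MemLp w 2 μT) (hζ : AEStronglyMeasurable ζ μT) :
    MemLp ζ 2 μT ∧ eLpNorm ζ 2 μT ≤ ENNReal.ofReal γ * eLpNorm w 2 μT := by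
  set f : ℕ → ℝ → ℝ≥0∞ := fun n =>
    (Icc (0 : ℝ) n).indicator fun t => ENNReal.ofReal (min (‖ζ t‖ ^ 2) n)
  have hfm : ∀ n, AEMeasurable (f n) μT := fun n =>
    (((hζ.norm.pow 2).inf aestronglyMeasurable_const).aemeasurable.ennreal_ofReal).indicator
      measurableSet_Icc
  have hlim : ∀ᵐ t ∂μT, liminf (fun n => f n t) atTop = ENNReal.ofReal (‖ζ t‖ ^ 2) := by
    filter_upwards [ae_restrict_mem measurableSet_Ici] with t ht
    refine Tendsto.liminf_eq (tendsto_const_nhds.congr' ?_)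
    filter_upwards [eventually_ge_atTop ⌈t⌉₊, eventually_ge_atTop ⌈‖ζ t‖ ^ 2⌉₊] with n h1 h2
    have hmem : t ∈ Icc (0 : ℝ) n := ⟨ht, Nat.ceil_le.1 h1⟩
    rw [show f n t = _ from indicator_of_mem hmem _, min_eq_left (Nat.ceil_le.1 h2)]
  have hint : ∫⁻ t, ENNReal.ofReal (‖ζ t‖ ^ 2) ∂μT ≤
      ∫⁻ t, ENNReal.ofReal (γ ^ 2 * ‖w t‖ ^ 2) ∂μT := by
    rw [← lintegral_congr_ae hlim]
    refine (lintegral_liminf_le' hfm).trans (liminf_le_of_le (by isBoundedDefault) ?_)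
    intro b hb
    obtain ⟨n, hbn⟩ := hb.exists
    refine hbn.trans ?_
    rw [lintegral_indicator measurableSet_Icc,
      Measure.restrict_restrict_of_subset Icc_subset_Ici_self]
    exact setLIntegral_truncation_le hV0 hVnonneg hV hdis hw hζ n
  have hle : eLpNorm ζ 2 μT ≤ ENNReal.ofReal γ * eLpNorm w 2 μT := by
    rw [← Real.enorm_of_nonneg hγ, ← eLpNorm_const_smul,
      eLpNorm_eq_lintegral_rpow_enorm_toReal (by norm_num) (by norm_num),
      eLpNorm_eq_lintegral_rpow_enorm_toReal (by norm_num) (by norm_num)]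
    refine ENNReal.rpow_le_rpow ?_ (by norm_num)
    have hsq : ∀ x : ℝ, 0 ≤ x → ENNReal.ofReal x ^ (2 : ℝ≥0∞).toReal = ENNReal.ofReal (x ^ 2) :=
      fun x hx => by rw [ENNReal.toReal_ofNat, ENNReal.rpow_ofNat, ENNReal.ofReal_pow hx]
    simpa only [← ofReal_norm, hsq _ (norm_nonneg _),
      hsq _ (mul_nonneg (abs_nonneg γ) (norm_nonneg _)), Pi.smul_apply, norm_smul, mul_pow,
      Real.norm_eq_abs, sq_abs] using hint
  exact ⟨⟨hζ, hle.trans_lt (ENNReal.mul_lt_top ENNReal.ofReal_lt_top hw.2)⟩, hle⟩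

end Dissipation

/-! ### Uniqueness of weak derivatives -/

theorem IsWeakDeriv.eq_zero {n i j : ℕ} {f g : L2S (Fin n)} (h : IsWeakDeriv i j f g)
    (hf : f = 0) : g = 0 := by
  have hU : IsOpen (Ioo (0 : ℝ) 1 ×ˢ Ioo (0 : ℝ) 1) := isOpen_Ioo.prod isOpen_Ioo
  have hint : Integrable g μS := (Lp.memLp g).integrable (by norm_num)
  -- the test functions are supported in the open square, which has full measure
  have h0 : ∀ᵐ p ∂μS, p ∈ Ioo (0 : ℝ) 1 ×ˢ Ioo (0 : ℝ) 1 → g p = 0 := by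
    refine hU.ae_eq_zero_of_integral_contDiff_smul_eq_zero
      (hint.locallyIntegrable.locallyIntegrableOn _) fun φ hφ hc hs => ?_
    have h1 := h φ ⟨hφ, hc, hs⟩
    have h2 : ∫ p, (dX^[i] (dY^[j] φ)) p • f p ∂μS = 0 := by
      refine integral_eq_zero_of_ae ?_
      rw [hf]
      filter_upwards [Lp.coeFn_zero (Vec (Fin n)) 2 μS] with p hp
      rw [hp]
      exact smul_zero _
    rw [h2] at h1
    exact (smul_eq_zero.1 h1.symm).resolve_left (pow_ne_zero _ (by norm_num))
  have hmem : ∀ᵐ p ∂μS, p ∈ Ioo (0 : ℝ) 1 ×ˢ Ioo (0 : ℝ) 1 := by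
    have hI : ∀ᵐ x ∂μI, x ∈ Ioo (0 : ℝ) 1 := by
      have : μI = volume.restrict (Ioo (0 : ℝ) 1) := restrict_Ioo_eq_restrict_Icc.symm
      rw [this]
      exact ae_restrict_mem measurableSet_Ioo
    filter_upwards [measurePreserving_fst.quasiMeasurePreserving.ae hI,
      measurePreserving_snd.quasiMeasurePreserving.ae hI] with p h1 h2 using ⟨h1, h2⟩
  refine Lp.ext ?_
  filter_upwards [h0, hmem, Lp.coeFn_zero (Vec (Fin n)) 2 μS] with p hp hm hz
  rw [hz, hp hm]
  rfl

/-- A state in `X` is determined by its class in `L²`, since this class determines all its weak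
derivatives. -/
theorem PDEData.toL2_injective {nu nw nz nq1 nq2 nq3 : ℕ} (G : PDEData nu nw nz nq1 nq2 nq3) :
    Function.Injective G.toL2 := by
  rw [injective_iff_map_eq_zero]
  intro u hu
  refine Subtype.ext (funext fun i => funext fun j => ?_)
  exact (u.2.1 i j).eq_zero hu

/-- The values of a solution depend measurably on time as elements of `X`, although the
differentiability of `u` only refers to the weaker norm of `L²`: by the Lusin-Souslin theorem the
continuous injection `X → L²` is a measurable embedding. -/
theorem PDEData.IsSolution.aestronglyMeasurable_comp {nu nw nz nq1 nq2 nq3 : ℕ}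
    {G : PDEData nu nw nz nq1 nq2 nq3} {w : ℝ → Vec (Fin nw)} {u₀ : G.X} {u : ℝ → G.X}
    {z : ℝ → Vec (Fin nz)} {q₁ : ℝ → Vec (Fin nq1)} {q₂ : ℝ → L2I (Fin nq2)}
    {q₃ : ℝ → L2I (Fin nq3)} (hu : G.IsSolution w u₀ u z q₁ q₂ q₃) {n : ℕ}
    (Φ : G.X →L[ℝ] Vec (Fin n)) : AEStronglyMeasurable (fun t => Φ (u t)) μT := by
  let : MeasurableSpace G.X := borel _
  have : BorelSpace G.X := ⟨rfl⟩
  let : MeasurableSpace (L2S (Fin nu)) := borel _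
  have : BorelSpace (L2S (Fin nu)) := ⟨rfl⟩
  have : Fact ((2 : ℝ≥0∞) ≠ ⊤) := ⟨by norm_num⟩
  have : SecondCountableTopology (L2S (Fin nu)) := inferInstance
  have : SecondCountableTopology (Jet nu) := inferInstance
  have : SecondCountableTopology G.X := TopologicalSpace.Subtype.secondCountableTopology _
  have : PolishSpace G.X := inferInstance
  have hemb : MeasurableEmbedding G.toL2 :=
    G.toL2.continuous.measurableEmbedding G.toL2_injective
  have hcont : ContinuousOn (G.toL2 ∘ u) (Ici 0) := fun t ht => (hu.dyn t ht).continuousWithinAt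
  have hum : AEMeasurable u μT :=
    hemb.aemeasurable_comp_iff.1 (hcont.aemeasurable measurableSet_Ici)
  exact (Φ.continuous.measurable.comp_aemeasurable hum).aestronglyMeasurable

/-! ### Coercive operators -/

section LPI

variable {H : Type} [NormedAddCommGroup H] [InnerProductSpace ℝ H] [CompleteSpace H]

theorem IsPosDefOp.nonneg {P : H →L[ℝ] H} (hP : IsPosDefOp P) (v : H) : 0 ≤ inner ℝ v (P v) := by
  obtain ⟨ε, hε, h⟩ := hP.2
  exact (by positivity : 0 ≤ ε * ‖v‖ ^ 2).trans (h v)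

/-- By the Lax-Milgram theorem a coercive operator is invertible, so that `P.inverse` is a genuine
inverse. -/
theorem IsPosDefOp.apply_inverse {P : H →L[ℝ] H} (hP : IsPosDefOp P) (v : H) :
    P (P.inverse v) = v := by
  obtain ⟨ε, hε, h⟩ := hP.2
  have hco : IsCoercive (innerSL ℝ ∘L P : H →L[ℝ] H →L[ℝ] ℝ) :=
    ⟨ε, hε, fun u => by
      have := h u
      rw [real_inner_comm] at this
      rwa [sq, ← mul_assoc] at this⟩
  have heq : (hco.continuousLinearEquivOfBilin : H →L[ℝ] H) = P := by
    ext u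
    exact (hco.unique_continuousLinearEquivOfBilin fun x => rfl).symm
  rw [← heq, ContinuousLinearMap.inverse_equiv]
  exact hco.continuousLinearEquivOfBilin.apply_symm_apply v

theorem IsPosDefOp.hasDerivWithinAt {P : H →L[ℝ] H} (hP : IsPosDefOp P) {f : ℝ → H} {f' : H}
    {s : Set ℝ} {t : ℝ} (hf : HasDerivWithinAt f f' s t) :
    HasDerivWithinAt (fun τ => inner ℝ (f τ) (P (f τ))) (2 * inner ℝ (f t) (P f')) s t := by
  have h1 := hf.inner ℝ (P.hasFDerivAt.comp_hasDerivWithinAt t hf)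
  refine h1.congr_deriv ?_
  have h2 : inner ℝ f' (P (f t)) = inner ℝ (f t) (P f') := by
    rw [← ContinuousLinearMap.adjoint_inner_left, hP.1.adjoint_eq, real_inner_comm]
  simp only [Function.comp_apply]
  rw [h2]; ring

end LPI

/-! ### The error of the estimator -/

theorem solOp_fundState {n : ℕ} (E : BCMatrix n) (hE : WellPosed E) (u : bcSpace E) :
    solOp E hE (fundState E u) = u :=
  (ContinuousLinearEquiv.ofBijective (fundState E) (LinearMap.ker_eq_bot.2 hE.1)
    (LinearMap.range_eq_top.2 hE.2)).symm_apply_apply u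

/-- An operator `Φ 𝒯` of the PIE, applied to the difference of `v` and the fundamental state of `u`,
in terms of the corresponding operator `Φ` of the PDE. -/
theorem comp_solOp_sub_fundState {n : ℕ} (E : BCMatrix n) (hE : WellPosed E) {F : Type*}
    [NormedAddCommGroup F] [NormedSpace ℝ F] (Φ : bcSpace E →L[ℝ] F) (v : L2S (Fin n))
    (u : bcSpace E) :
    (Φ ∘L solOp E hE) (v - fundState E u) = (Φ ∘L solOp E hE) v - Φ u := by
  rw [map_sub]
  exact congrArg (_ - Φ ·) (solOp_fundState E hE u)

/-- The linear PI inequality, times `γ`, at `(γ⁻¹ ζ, w, e)`, where `ζ = 𝒞 e - 𝒟 w`; this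
first argument maximizes `a ↦ 2 ⟪a, ζ⟫ - γ ‖a‖²`, the part of the form that involves it. -/
theorem PDEData.LPI.dissipation {nu nw nz nq1 nq2 nq3 : ℕ} {G : PDEData nu nw nz nq1 nq2 nq3}
    {hG : WellPosed G.E} {γ : ℝ} (hγ : 0 < γ) {P : L2S (Fin nu) →L[ℝ] L2S (Fin nu)}
    {W₁ : Vec (Fin nq1) →L[ℝ] L2S (Fin nu)} {W₂ : L2I (Fin nq2) →L[ℝ] L2S (Fin nu)}
    {W₃ : L2I (Fin nq3) →L[ℝ] L2S (Fin nu)} (hP : IsSelfAdjoint P)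
    (h : G.LPI hG γ P W₁ W₂ W₃) (w : Vec (Fin nw)) (e : L2S (Fin nu)) :
    γ * (2 * inner ℝ (G.opT hG e)
      (P (G.opA hG e - G.opB w) + (W₁ (G.opC1 hG e - G.opD1 w) + W₂ (G.opC2 hG e - G.opD2 w)
        + W₃ (G.opC3 hG e - G.opD3 w))))
      + ‖G.opC hG e - G.opD w‖ ^ 2 ≤ γ ^ 2 * ‖w‖ ^ 2 := by
  have h1 := h (γ⁻¹ • (G.opC hG e - G.opD w)) w e
  set ζ := G.opC hG e - G.opD w with hζ
  have hsym : ∀ x y, inner ℝ x (P y) = inner ℝ (P x) y := fun x y => by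
    rw [← ContinuousLinearMap.adjoint_inner_left, hP.adjoint_eq]
  have hC : G.opC hG e = ζ + G.opD w := by rw [hζ]; abel
  simp only [hC, ContinuousLinearMap.adjoint_inner_right, ContinuousLinearMap.adjoint_inner_left,
    map_neg, map_add, neg_apply, add_apply, smul_apply, ContinuousLinearMap.comp_apply,
    ContinuousLinearMap.id_apply, inner_add_right, inner_add_left, inner_neg_right,
    real_inner_smul_left, real_inner_smul_right, map_smul, real_inner_self_eq_norm_sq] at h1
  simp only [map_sub, inner_add_right, inner_sub_right]
  rw [hsym (G.opB w), ← hsym _ (G.opB w)] at h1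
  simp only [real_inner_comm (G.opT hG e)] at h1
  have hinv : γ * γ⁻¹ = 1 := mul_inv_cancel₀ hγ.ne'
  linear_combination γ * h1 + (γ * γ⁻¹ - 1) * ‖ζ‖ ^ 2 * hinv

end PIE2D

theorem mainTheorem1 {nu nw nz nq1 nq2 nq3 : ℕ} (G : PDEData nu nw nz nq1 nq2 nq3)
    (hG : WellPosed G.E) (γ : ℝ) (hγ : 0 < γ)
    (P : L2S (Fin nu) →L[ℝ] L2S (Fin nu)) (W₁ : Vec (Fin nq1) →L[ℝ] L2S (Fin nu))
    (W₂ : L2I (Fin nq2) →L[ℝ] L2S (Fin nu)) (W₃ : L2I (Fin nq3) →L[ℝ] L2S (Fin nu))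
    (hP : IsPI2D P) (hW₁ : IsPI2D0 W₁) (hW₂ : IsPI2D1D W₂) (hW₃ : IsPI2D1D W₃)
    (hPpos : IsPosDefOp P) (hLPI : G.LPI hG γ P W₁ W₂ W₃)
    (w : ℝ → Vec (Fin nw)) (hw : MemLp w 2 μT) (u₀ : G.X)
    (u : ℝ → G.X) (z : ℝ → Vec (Fin nz)) (q₁ : ℝ → Vec (Fin nq1))
    (q₂ : ℝ → L2I (Fin nq2)) (q₃ : ℝ → L2I (Fin nq3))
    (hu : G.IsSolution w u₀ u z q₁ q₂ q₃)
    (v' : ℝ → L2S (Fin nu)) (z' : ℝ → Vec (Fin nz))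
    (hv : G.IsEstimator hG (P.inverse ∘L W₁) (P.inverse ∘L W₂) (P.inverse ∘L W₃) q₁ q₂ q₃
      (fundState G.E u₀) v' z') :
    MemLp (fun t => z' t - z t) 2 μT ∧
      eLpNorm (fun t => z' t - z t) 2 μT ≤ ENNReal.ofReal γ * eLpNorm w 2 μT := by
  -- the error `e` of the estimate of the fundamental state; only `𝒯 e` is known to be differentiable
  set e : ℝ → L2S (Fin nu) := fun t => v' t - fundState G.E (u t) with he
  have hTe : ∀ t, G.opT hG (e t) = G.opT hG (v' t) - G.toL2 (u t) := fun t =>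
    comp_solOp_sub_fundState G.E hG G.toL2 (v' t) (u t)
  have hAe : ∀ t, G.opA hG (e t) = G.opA hG (v' t) - G.dynOp (u t) := fun t =>
    comp_solOp_sub_fundState G.E hG G.dynOp (v' t) (u t)
  have hCe : ∀ t, G.opC hG (e t) = G.opC hG (v' t) - G.outOp (u t) := fun t =>
    comp_solOp_sub_fundState G.E hG G.outOp (v' t) (u t)
  have hC1e : ∀ t, G.opC1 hG (e t) = G.opC1 hG (v' t) - G.obsOp1 (u t) := fun t =>
    comp_solOp_sub_fundState G.E hG G.obsOp1 (v' t) (u t)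
  have hC2e : ∀ t, G.opC2 hG (e t) = G.opC2 hG (v' t) - G.obsOp2 (u t) := fun t =>
    comp_solOp_sub_fundState G.E hG G.obsOp2 (v' t) (u t)
  have hC3e : ∀ t, G.opC3 hG (e t) = G.opC3 hG (v' t) - G.obsOp3 (u t) := fun t =>
    comp_solOp_sub_fundState G.E hG G.obsOp3 (v' t) (u t)
  have hζ : ∀ t, 0 ≤ t → z' t - z t = G.opC hG (e t) - G.opD (w t) := fun t ht => by
    rw [hv.out t ht, hu.out t ht, hCe, sub_add_eq_sub_sub]
    rfl
  -- `W (𝒞_q e - 𝒟_q w)`, the output error injected by the estimator before applying `P⁻¹`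
  set r : ℝ → L2S (Fin nu) := fun t => W₁ (G.opC1 hG (e t) - G.opD1 (w t)) +
    W₂ (G.opC2 hG (e t) - G.opD2 (w t)) + W₃ (G.opC3 hG (e t) - G.opD3 (w t)) with hr
  have hdyn : ∀ t, 0 ≤ t → HasDerivWithinAt (fun s => G.opT hG (e s))
      (G.opA hG (e t) - G.opB (w t) + P.inverse (r t)) (Set.Ici 0) t := fun t ht => by
    obtain ⟨d, hd, hd'⟩ := hv.dyn t ht
    have h1 := ((G.opT hG).hasFDerivAt.comp_hasDerivWithinAt t hd).sub (hu.dyn t ht)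
    refine (h1.congr_deriv ?_).congr_of_mem (fun s _ => hTe s) ht
    have h1 : G.opC1 hG (e t) - G.opD1 (w t) = G.opC1 hG (v' t) - q₁ t := by
      rw [hC1e, hu.obs1 t ht, sub_add_eq_sub_sub]; rfl
    have h2 : G.opC2 hG (e t) - G.opD2 (w t) = G.opC2 hG (v' t) - q₂ t := by
      rw [hC2e, hu.obs2 t ht, sub_add_eq_sub_sub]; rfl
    have h3 : G.opC3 hG (e t) - G.opD3 (w t) = G.opC3 hG (v' t) - q₃ t := by
      rw [hC3e, hu.obs3 t ht, sub_add_eq_sub_sub]; rfl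
    have h4 : G.opB (w t) = vecMulOp G.B G.hB (w t) := rfl
    rw [hd', hr, hAe, h4]
    simp only [h1, h2, h3, map_add, ContinuousLinearMap.comp_apply]
    abel
  have hmeas : AEStronglyMeasurable (fun t => z' t - z t) μT := by
    have hv' : ContinuousOn v' (Set.Ici 0) := fun t ht => by
      obtain ⟨d, hd, -⟩ := hv.dyn t ht
      exact hd.continuousWithinAt
    have h1 : AEStronglyMeasurable (fun t => G.opC hG (v' t)) μT :=
      ((G.opC hG).continuous.comp_continuousOn hv').aestronglyMeasurable measurableSet_Ici
    have h2 := hu.aestronglyMeasurable_comp G.outOp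
    have h3 := G.opD.continuous.comp_aestronglyMeasurable hw.1
    refine ((h1.sub h2).sub h3).congr ?_
    filter_upwards [ae_restrict_mem measurableSet_Ici] with t ht
    rw [hζ t ht, hCe]
    rfl
  refine eLpNorm_le_of_dissipation hγ.le
    (V := fun t => γ * inner ℝ (G.opT hG (e t)) (P (G.opT hG (e t))))
    (V' := fun t => γ * (2 * inner ℝ (G.opT hG (e t))
      (P (G.opA hG (e t) - G.opB (w t) + P.inverse (r t)))))
    ?_ (fun t _ => mul_nonneg hγ.le (hPpos.nonneg _))
    (fun t ht => (hPpos.hasDerivWithinAt (hdyn t ht)).const_mul γ) (fun t ht => ?_) hw hmeas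
  · have h0 : e 0 = 0 := by
      rw [he]
      simp only [hv.init, hu.init, sub_self]
    simp only [h0, map_zero, inner_zero_left, mul_zero]
  · rw [hζ t ht, map_add P, hPpos.apply_inverse]
    exact hLPI.dissipation hγ hPpos.1 (w t) (e t)
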